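/- Let $s\in\{\tfrac12,1,\tfrac32,2,\dots\}$ be a fixed spin and let $V^j$ denote the irreducible representation of $\mathrm{SU}(2)$ of spin $j$, of dimension $2j+1$. Let ${}^s d^{(n)}_0$ be the multiplicity of the trivial representation $V^0$ in $(V^s)^{\otimes n}$. Let ${\rm RW}^{(s)}_n(0)$ be the number of $n$-step walks from $0$ to $0$ on $\tfrac12\mathbb Z$ in which each step goes from a position $x$ to one of the $2s+1$ positions $x-s,x-s+1,\dots,x+s$. Let ${\rm RWM}^{(s)}_n(0)$ be the number of $n$-step walks from $0$ to $0$ on $\tfrac12\mathbb Z_{\ge 0}$ in which each step goes from a position $j$ to one of the positions $|j-s|,|j-s|+1,\dots,j+s$ (the walk with a mirror at the origin). Then for all $n\ge 0$ the multiplicity ${}^s d^{(n)}_0$ equals ${\rm RWM}^{(s)}_n(0)$ and equals the dimension of the intertwiner space, i.e. of the $\mathrm{SU}(2)$-invariant subspace of $(V^s)^{\otimes n}$. Moreover there are constants $C_s>0$, $C'_s>0$ and $c_s\in\mathbb R$, depending only on $s$, such that, as $n\to\infty$ (through all integers if $s$ is an integer, and through the even integers if $s$ is a half-integer), $${\rm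 RW}^{(s)}_n(0)\sim C_s\,\frac{(2s+1)^n}{\sqrt n},\qquad {}^s d^{(n)}_0={\rm RWM}^{(s)}_n(0)\sim C'_s\,\frac{(2s+1)^n}{n\sqrt n},$$ where $a_n\sim b_n$ means $a_n/b_n\to 1$. Hence the entropy $S^{(s)}_n=\ln {}^s d^{(n)}_0$ satisfies $$S^{(s)}_n=n\ln(2s+1)-\tfrac32\ln n+c_s+o(1),$$ so that the coefficient $-\tfrac32$ of the logarithmic correction does not depend on $s$. -/

import Mathlib

open Filter Topology Asymptotics
open scoped TensorProduct

noncomputable section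

namespace SpinHorizon

/-- The group `SU(2)`. -/
abbrev SU2 : Type := Matrix.specialUnitaryGroup (Fin 2) ℂ

/-- Linear substitution of variables: `g` sends the variable `X i` to `∑ j, g j i • X j`, i.e. it
acts on the span of the two variables as on the standard basis of `ℂ²`. -/
def subst (g : Matrix (Fin 2) (Fin 2) ℂ) :
    MvPolynomial (Fin 2) ℂ →ₐ[ℂ] MvPolynomial (Fin 2) ℂ :=
  MvPolynomial.aeval fun i => ∑ j, MvPolynomial.C (g j i) * MvPolynomial.X j

theorem subst_X (g : Matrix (Fin 2) (Fin 2) ℂ) (i : Fin 2) :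
    subst g (MvPolynomial.X i) = ∑ j, MvPolynomial.C (g j i) * MvPolynomial.X j := by
  simp [subst]

theorem subst_one : subst 1 = AlgHom.id ℂ _ := by
  refine MvPolynomial.algHom_ext fun i => ?_
  rw [subst_X]
  fin_cases i <;> simp [Matrix.one_apply]

theorem subst_mul (g h : Matrix (Fin 2) (Fin 2) ℂ) :
    subst (g * h) = (subst g).comp (subst h) := by
  refine MvPolynomial.algHom_ext fun i => ?_
  rw [AlgHom.comp_apply, subst_X, subst_X]
  simp only [map_mul, subst_X, MvPolynomial.algHom_C, Matrix.mul_apply,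
    MvPolynomial.algebraMap_eq, Fin.sum_univ_two, map_add]
  ring

theorem subst_mem (g : Matrix (Fin 2) (Fin 2) ℂ) (k : ℕ) :
    ∀ p ∈ MvPolynomial.homogeneousSubmodule (Fin 2) ℂ k,
      (subst g).toLinearMap p ∈ MvPolynomial.homogeneousSubmodule (Fin 2) ℂ k := by
  intro p hp
  have := MvPolynomial.IsHomogeneous.aeval (n := 1) (show p.IsHomogeneous k from hp)
    (fun i => ∑ j, MvPolynomial.C (g j i) * MvPolynomial.X j) fun i =>
      MvPolynomial.IsHomogeneous.sum _ _ _ fun j _ => MvPolynomial.isHomogeneous_C_mul_X _ _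
  rw [one_mul] at this
  exact this

/-- The carrier of the irreducible representation `V^s` of spin `s = k / 2`: homogeneous
polynomials of degree `k = 2 s` in two complex variables (of dimension `k + 1 = 2 s + 1`). -/
abbrev SpinSpace (k : ℕ) : Type := MvPolynomial.homogeneousSubmodule (Fin 2) ℂ k

/-- The irreducible representation `V^s` of `SU(2)` of spin `s = k / 2`, that is, the `k`-th
symmetric power of the defining representation on `ℂ²`. -/
def spinRep (k : ℕ) : Representation ℂ SU2 (SpinSpace k) where
  toFun g := (subst (g : Matrix (Fin 2) (Fin 2) ℂ)).toLinearMap.restrict (subst_mem _ k)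
  map_one' := by
    ext p : 2
    simp [LinearMap.restrict_apply, subst_one]
  map_mul' g h := by
    ext p : 2
    simp [LinearMap.restrict_apply, subst_mul]

/-- The representation of `SU(2)` on the `n`-fold tensor product `(V^s)^{⊗ n}`, `s = k / 2`, where
`g` acts as `g ⊗ ⋯ ⊗ g`. -/
def tensorRep (k n : ℕ) : Representation ℂ SU2 (⨂[ℂ] _ : Fin n, SpinSpace k) where
  toFun g := PiTensorProduct.map fun _ => spinRep k g
  map_one' := by
    rw [map_one]
    exact PiTensorProduct.map_one
  map_mul' g h := by
    rw [map_mul]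
    exact PiTensorProduct.map_mul _ _

/-- The intertwiner space: the `SU(2)`-invariant subspace of `(V^s)^{⊗ n}`, `s = k / 2`. -/
def intertwinerSpace (k n : ℕ) : Submodule ℂ (⨂[ℂ] _ : Fin n, SpinSpace k) where
  carrier := {v | ∀ g : SU2, tensorRep k n g v = v}
  zero_mem' g := map_zero _
  add_mem' hv hw g := by rw [map_add, hv g, hw g]
  smul_mem' c v hv g := by rw [map_smul, hv g]

/-- The degeneracy of the spin `j = l / 2` in `(V^s)^{⊗ n}`, `s = k / 2`: the multiplicity of the
irreducible representation `V^j`, i.e. the dimension of the space of `SU(2)`-equivariant linear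
maps `V^j → (V^s)^{⊗ n}`. -/
def degeneracy (k n l : ℕ) : ℕ :=
  Module.finrank ℂ ((spinRep l).IntertwiningMap (tensorRep k n))

/-- The entropy of the horizon made of `n` patches of spin `s = k / 2`: the logarithm of the
degeneracy of the trivial representation `V^0` in `(V^s)^{⊗ n}`. -/
def entropy (k n : ℕ) : ℝ := Real.log (degeneracy k n 0)

/-- Given, for each position `x`, the finite set `next x` of positions that can be reached from `x`
in one step, `walkCount next n x y` is the number of `n`-step walks from `x` to `y`. -/
def walkCount {α : Type} [DecidableEq α] (next : α → Finset α) : ℕ → α → α → ℕ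
  | 0, x, y => if x = y then 1 else 0
  | n + 1, x, y => ∑ z ∈ next x, walkCount next n z y

/-- One step of the standard walk with jumps of length up to `s = k / 2`, in doubled coordinates
(`x` is twice the position): from the position `x / 2` one may move to
`x / 2 - s, x / 2 - s + 1, …, x / 2 + s`. -/
def freeStep (k : ℕ) (x : ℤ) : Finset ℤ :=
  (Finset.range (k + 1)).image fun i : ℕ => x - k + 2 * i

/-- One step of the walk with a mirror at the origin, in doubled coordinates: from the position
`j₀ = x / 2 ≥ 0` one may move to `|j₀ - s|, |j₀ - s| + 1, …, j₀ + s`, where `s = k / 2`. -/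
def mirrorStep (k x : ℕ) : Finset ℕ :=
  (Finset.range (x + k + 1)).filter fun y => |(x : ℤ) - k| ≤ y ∧ Even (x + k + y)

/-- `RW_n^{(s)}(j)` for `s = k / 2` and `j = m / 2`: the number of `n`-step walks from the origin
to `j` in the standard walk. -/
def RW (k n : ℕ) (m : ℤ) : ℕ := walkCount (freeStep k) n 0 m

/-- `RWM_n^{(s)}(j)` for `s = k / 2` and `j = m / 2`: the number of `n`-step walks from the origin
to `j` in the walk with a mirror at the origin. -/
def RWM (k n m : ℕ) : ℕ := walkCount (mirrorStep k) n 0 m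

/-- The limit `n → ∞` along the numbers `n` for which `n s = n k / 2` is an integer: all `n` if `s`
is an integer, the even `n` if `s` is a half-integer. -/
def integralTotal (k : ℕ) : Filter ℕ := atTop ⊓ 𝓟 {n | Even (n * k)}

end SpinHorizon

end

/-!
The multiplicity of `V^0` is the dimension of the space of invariants, since an equivariant map out
of the trivial representation is determined by the image of `1` (`degeneracy_zero`). Invariance
under `SU(2)` is turned into linear algebra by differentiating along the diagonal torus and the
real rotations, which generate the group (`exists_euler`): the invariants of `(V^s)^{⊗ n}` are the
vectors of weight `0` killed by the raising operator `e` of `sl₂` (`intertwinerSpace_eq`). In a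
finite-dimensional representation `e` maps the weight space `0` onto the weight space `2`, so the
invariants have dimension `#{weight 0} - #{weight 2}` (`finrank_ker_inf_ker_add_card`). A tensor
product of monomials is a weight vector, and its weight is the end point of a free walk; hence this
difference is `RW (0) - RW (2)` in doubled coordinates. By the reflection principle
(`walkCount_mirrorStep`) it is the number of walks with a mirror.

For the asymptotics, let `χ` be the character of `V^s`. Fourier inversion writes `π * RW` as the
integral of `χ ^ n` over `[-π / 2, π / 2]`, and `π * RWM` as twice that of `χ ^ n * sin ^ 2`
(`pi_mul_RW_zero`, `pi_mul_RWM_zero`). On this interval `|χ| / (2 s + 1)` is bounded by a Gaussian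
(`abs_spinChar_div_le`), so the substitution `θ = t / √n` and dominated convergence give a positive
Gaussian limit (`tendsto_laplace`). The factor `sin ^ 2` is what costs the additional `1 / n`, for
every spin, and is the origin of the universal coefficient `-3 / 2`.
-/

/-! ### The reflection principle -/

namespace SpinHorizon

theorem sum_freeStep {M : Type*} [AddCommMonoid M] (k : ℕ) (x : ℤ) (f : ℤ → M) :
    ∑ z ∈ freeStep k x, f z = ∑ i ∈ Finset.range (k + 1), f (x - k + 2 * i) := by
  rw [freeStep, Finset.sum_image]
  intro a _ b _ h
  simpa using h

/-- The free walk is invariant under every point reflection of the line. -/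
theorem walkCount_freeStep_reflect (k n : ℕ) (c x y : ℤ) :
    walkCount (freeStep k) n (c - x) (c - y) = walkCount (freeStep k) n x y := by
  induction n generalizing x with
  | zero => simp [walkCount]
  | succ n ih =>
    simp only [walkCount, sum_freeStep]
    rw [← Finset.sum_range_reflect]
    refine Finset.sum_congr rfl fun i hi => ?_
    rw [← ih]
    congr 1
    have : i ≤ k := by simpa [Nat.lt_succ_iff] using hi
    push_cast [Nat.sub_sub, Nat.cast_sub this, show k + 1 - 1 - i = k - i by omega]
    ring

/-- A walk from `x` is the same as the choice, at each of its steps, of one of the `k + 1` jumps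
`-k, -k + 2, …, k`. -/
theorem walkCount_freeStep_eq_card (k n : ℕ) (x y : ℤ) :
    walkCount (freeStep k) n x y =
      Fintype.card {p : Fin n → Fin (k + 1) // x + ∑ i, (2 * (p i : ℤ) - k) = y} := by
  rw [Fintype.card_subtype, Finset.card_filter]
  induction n generalizing x with
  | zero => simp [walkCount]
  | succ n ih =>
    rw [← (Fin.consEquiv fun _ : Fin (n + 1) => Fin (k + 1)).sum_comp, Fintype.sum_prod_type]
    simp only [walkCount, sum_freeStep, ih, Fin.consEquiv_apply, Fin.sum_univ_succ (n := n),
      Fin.cons_zero, Fin.cons_succ]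
    rw [Finset.sum_range]
    refine Finset.sum_congr rfl fun i _ => Finset.sum_congr rfl fun p _ => ?_
    congr 2
    ring

theorem mirrorStep_eq_image (k x : ℕ) :
    mirrorStep k x =
      (Finset.range (min x k + 1)).image fun j => (max x k - min x k) + 2 * j := by
  ext y
  simp only [mirrorStep, Finset.mem_filter, Finset.mem_range, Finset.mem_image, abs_le]
  constructor
  · rintro ⟨h1, h2, m, hm⟩
    exact ⟨(y - (max x k - min x k)) / 2, by omega, by omega⟩
  · rintro ⟨j, hj, rfl⟩
    exact ⟨by omega, by omega, max x k + j, by omega⟩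

/-- For a function that is odd about `-1`, the mirrored jumps and the free jumps have the same sum:
the jumps across the mirror cancel in pairs. -/
theorem sum_mirrorStep (k x : ℕ) (f : ℤ → ℤ) (hf : ∀ z, f (-2 - z) = -f z) :
    ∑ z ∈ mirrorStep k x, f z = ∑ i ∈ Finset.range (k + 1), f (x - k + 2 * i) := by
  rw [mirrorStep_eq_image, Finset.sum_image (by intro a _ b _ h; simpa using h)]
  rcases le_total k x with h | h
  · rw [min_eq_right h, max_eq_left h]
    exact Finset.sum_congr rfl fun i _ => by push_cast [Nat.cast_sub h]; rfl
  · obtain ⟨d, rfl⟩ := Nat.exists_eq_add_of_le h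
    rw [min_eq_left h, max_eq_right h, show x + d + 1 = d + (x + 1) by ring,
      Finset.sum_range_add (fun i : ℕ => f (x - (x + d : ℕ) + 2 * i)) d]
    -- The jumps to `x - k, …, k - x - 2` are permuted by the reflection about `-1`.
    have h0 : ∑ i ∈ Finset.range d, f (x - (x + d : ℕ) + 2 * i) = 0 := by
      have h1 := Finset.sum_range_reflect (fun i : ℕ => f (x - (x + d : ℕ) + 2 * i)) d
      have h2 : ∑ i ∈ Finset.range d, f (x - (x + d : ℕ) + 2 * (d - 1 - i : ℕ)) =
          -∑ i ∈ Finset.range d, f (x - (x + d : ℕ) + 2 * i) := by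
        rw [← Finset.sum_neg_distrib]
        refine Finset.sum_congr rfl fun i hi => ?_
        rw [← hf]
        have : i < d := by simpa using hi
        congr 1
        omega
      omega
    rw [h0, zero_add]
    refine Finset.sum_congr rfl fun i _ => ?_
    congr 1
    push_cast
    omega

/-- The reflection principle: the walks that would cross the mirror are those that end at the
mirror image `-2 - y` of the end point. -/
theorem walkCount_mirrorStep (k n x y : ℕ) :
    (walkCount (mirrorStep k) n x y : ℤ) =
      walkCount (freeStep k) n x y - walkCount (freeStep k) n x (-2 - y) := by
  induction n generalizing x with
  | zero =>
    have : (x : ℤ) ≠ -2 - y := by omega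
    simp [walkCount, this]
  | succ n ih =>
    simp only [walkCount, Nat.cast_sum, ih, sum_freeStep, ← Finset.sum_sub_distrib]
    refine sum_mirrorStep k x (fun z => (walkCount (freeStep k) n z y : ℤ) -
      walkCount (freeStep k) n z (-2 - y)) fun z => ?_
    have h := walkCount_freeStep_reflect k n (-2) z (-2 - y)
    rw [sub_sub_cancel] at h
    rw [h, walkCount_freeStep_reflect]
    ring

theorem RWM_zero_add_RW_two (k n : ℕ) : RWM k n 0 + RW k n 2 = RW k n 0 := by
  have h1 := walkCount_mirrorStep k n 0 0
  have h2 := walkCount_freeStep_reflect k n 0 0 2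
  simp only [RWM, RW]
  simp only [Nat.cast_zero, sub_zero, zero_sub] at h1 h2
  omega

end SpinHorizon

/-! ### Finite-dimensional representations of `sl₂` -/

namespace SpinHorizon

section SlTwo

open Module

variable {T : Type*} [AddCommGroup T] [Module ℂ T] {h e f : End ℂ T}

theorem apply_apply_of_commutator (hhe : h * e - e * h = (2 : ℂ) • e) {μ : ℂ} {v : T}
    (hv : h v = μ • v) : h (e v) = (μ + 2) • e v := by
  have := LinearMap.congr_fun hhe v
  simp only [LinearMap.sub_apply, Module.End.mul_apply, LinearMap.smul_apply, hv, map_smul] at this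
  rw [sub_eq_iff_eq_add] at this
  rw [this, add_smul, add_comm]

/-- If `v` has weight `m > 0` and `f e v = -c v` with `c > 0`, then `e v` is in the same situation,
so that `v` vanishes as soon as `e` is nilpotent on it. -/
theorem eq_zero_of_lower_raise (hef : e * f - f * e = h) (hhe : h * e - e * h = (2 : ℂ) • e)
    (N : ℕ) {m c : ℝ} {v : T} (hm : 0 < m) (hc : 0 < c) (hv : h v = (m : ℂ) • v)
    (hfe : f (e v) = -(c : ℂ) • v) (hN : (e ^ N) v = 0) : v = 0 := by
  induction N generalizing m c v with
  | zero => simpa using hN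
  | succ N ih =>
    have h1 := apply_apply_of_commutator hhe hv
    have h2 := LinearMap.congr_fun hef (e v)
    simp only [LinearMap.sub_apply, Module.End.mul_apply, hfe, h1, map_smul] at h2
    have h3 : e v = 0 := by
      refine ih (m := m + 2) (c := c + (m + 2)) (by positivity) (by positivity) ?_ ?_ ?_
      · rw [h1]; push_cast; rfl
      · rw [sub_eq_iff_eq_add, ← sub_eq_iff_eq_add'] at h2
        rw [← h2, ← sub_smul]
        congr 1
        push_cast
        ring
      · rw [pow_succ, Module.End.mul_apply] at hN
        exact hN
    rw [h3, map_zero, eq_comm, smul_eq_zero] at hfe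
    exact hfe.resolve_left (by simpa using hc.ne')

/-- The raising operator is nilpotent on weight vectors: the weights `μ + 2 N` cannot all occur. -/
theorem exists_pow_apply_eq_zero [FiniteDimensional ℂ T] (hhe : h * e - e * h = (2 : ℂ) • e)
    {μ : ℂ} {v : T} (hv : h v = μ • v) : ∃ N : ℕ, (e ^ N) v = 0 := by
  by_contra! hne
  have hw (N : ℕ) : h ((e ^ N) v) = (μ + 2 * N) • (e ^ N) v := by
    induction N with
    | zero => simpa using hv
    | succ N ih =>
      rw [pow_succ', Module.End.mul_apply, apply_apply_of_commutator hhe ih]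
      congr 1
      push_cast
      ring
  have hinj : Function.Injective fun N : ℕ => μ + 2 * (N : ℂ) := fun a b hab => by simpa using hab
  refine Set.infinite_of_injective_forall_mem hinj (s := {ν | h.HasEigenvalue ν}) (fun N => ?_)
    (Module.End.finite_hasEigenvalue h)
  exact Module.End.hasEigenvalue_of_hasEigenvector
    ⟨Module.End.mem_eigenspace_iff.2 (hw N), hne N⟩

/-- A highest weight vector of weight `-2` vanishes. -/
theorem eq_zero_of_raise_eq_zero [FiniteDimensional ℂ T] (hef : e * f - f * e = h)
    (hhf : h * f - f * h = -(2 : ℂ) • f) {v : T} (hv : h v = -(2 : ℂ) • v) (hev : e v = 0) :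
    v = 0 := by
  have hhf' : -h * f - f * -h = (2 : ℂ) • f := by
    rw [neg_mul, mul_neg, sub_neg_eq_add, neg_add_eq_sub, ← neg_sub, hhf, neg_smul, neg_neg]
  have hv' : (-h) v = (2 : ℂ) • v := by rw [LinearMap.neg_apply, hv, neg_smul, neg_neg]
  obtain ⟨N, hN⟩ := exists_pow_apply_eq_zero hhf' hv'
  have key := LinearMap.congr_fun hef v
  simp only [LinearMap.sub_apply, Module.End.mul_apply, hev, map_zero, sub_zero, hv] at key
  refine eq_zero_of_lower_raise (h := -h) (e := f) (f := e) (by rw [← hef, neg_sub]) hhf' N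
    (m := 2) (c := 2) two_pos two_pos ?_ ?_ hN
  · simpa using hv'
  · simpa using key

/-- In a finite-dimensional representation of `sl₂`, the vectors killed by `h` and `e` are counted
by the weights `0` and `2`: `e` maps the weight space `0` onto the weight space `2`, because `e f` is
injective on the latter. -/
theorem finrank_ker_inf_ker_add_finrank_eigenspace_two [FiniteDimensional ℂ T]
    (hef : e * f - f * e = h) (hhe : h * e - e * h = (2 : ℂ) • e)
    (hhf : h * f - f * h = -(2 : ℂ) • f) :
    finrank ℂ ↥(LinearMap.ker h ⊓ LinearMap.ker e) + finrank ℂ (h.eigenspace 2) =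
      finrank ℂ (h.eigenspace 0) := by
  have he : ∀ v ∈ h.eigenspace 0, e v ∈ h.eigenspace 2 := fun v hv => by
    rw [Module.End.mem_eigenspace_iff] at hv ⊢
    simpa using apply_apply_of_commutator hhe hv
  have hf : ∀ v ∈ h.eigenspace 2, f v ∈ h.eigenspace 0 := fun v hv => by
    rw [Module.End.mem_eigenspace_iff] at hv ⊢
    have := LinearMap.congr_fun hhf v
    simp only [LinearMap.sub_apply, Module.End.mul_apply, LinearMap.smul_apply, hv, map_smul] at this
    rw [sub_eq_iff_eq_add] at this
    rw [this, ← add_smul]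
    simp
  set e' := e.restrict he
  set f' := f.restrict hf
  have hinj : Function.Injective (e' ∘ₗ f') := by
    rw [← LinearMap.ker_eq_bot, LinearMap.ker_eq_bot']
    rintro ⟨v, hv⟩ hz
    have hz' : e (f v) = 0 := congrArg Subtype.val hz
    rw [Module.End.mem_eigenspace_iff] at hv
    obtain ⟨N, hN⟩ := exists_pow_apply_eq_zero hhe hv
    have key := LinearMap.congr_fun hef v
    simp only [LinearMap.sub_apply, Module.End.mul_apply, hz', zero_sub, hv] at key
    refine Subtype.ext (eq_zero_of_lower_raise hef hhe N (m := 2) (c := 2) two_pos two_pos ?_ ?_ hN)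
    · simpa using hv
    · rw [neg_smul, ← neg_eq_iff_eq_neg]
      simpa using key
  have hsurj : Function.Surjective e' := by
    have := LinearMap.surjective_of_injective hinj
    rw [LinearMap.coe_comp] at this
    exact this.of_comp
  have hrn := e'.finrank_range_add_finrank_ker
  rw [LinearMap.range_eq_top.2 hsurj, finrank_top, add_comm] at hrn
  rw [← hrn]
  congr 1
  have hker : LinearMap.ker e' = Submodule.comap (h.eigenspace 0).subtype
      (LinearMap.ker h ⊓ LinearMap.ker e) := by
    ext ⟨v, hv⟩
    rw [Module.End.mem_eigenspace_iff, zero_smul] at hv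
    simp [e', LinearMap.restrict_apply]
  rw [hker]
  refine (Submodule.comapSubtypeEquivOfLe ?_).finrank_eq.symm
  rw [Module.End.eigenspace_zero]
  exact inf_le_left

/-- The eigenspaces of a diagonal operator are counted by its diagonal entries. -/
theorem finrank_eigenspace_eq_card {ι : Type*} [Fintype ι] (b : Basis ι ℂ T) {wt : ι → ℤ}
    (hb : ∀ i, h (b i) = (wt i : ℂ) • b i) (m : ℤ) :
    finrank ℂ (h.eigenspace (m : ℂ)) = Fintype.card {i // wt i = m} := by
  classical
  have hrepr (v : T) (i : ι) : b.repr (h v) i = wt i * b.repr v i := by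
    conv_lhs => rw [← b.sum_repr v]
    simp only [map_sum, map_smul, hb, Finsupp.coe_finsetSum, Finset.sum_apply,
      Finsupp.smul_apply, Basis.repr_self, Finsupp.single_apply, smul_eq_mul]
    simp [mul_comm]
  have : h.eigenspace (m : ℂ) =
      Submodule.span ℂ (Set.range fun i : {i // wt i = m} => b i) := by
    have hr : (Set.range fun i : {i // wt i = m} => b i) = b '' {i | wt i = m} := by
      ext; simp
    ext v
    rw [hr, Basis.mem_span_image, Module.End.mem_eigenspace_iff, ← b.repr.injective.eq_iff,
      Finsupp.ext_iff]
    simp only [hrepr, map_smul, Finsupp.smul_apply, smul_eq_mul, mul_eq_mul_right_iff,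
      Int.cast_inj]
    constructor
    · intro hv i hi
      exact (hv i).resolve_right (Finsupp.mem_support_iff.1 hi)
    · intro hv i
      by_cases hi : b.repr v i = 0
      · exact Or.inr hi
      · exact Or.inl (hv (Finsupp.mem_support_iff.2 hi))
  rw [this]
  exact finrank_span_eq_card (b.linearIndependent.comp _ Subtype.val_injective)

/-- If `h` is diagonal in a basis with integer weights, then the space of invariants has the
dimension `#{weight 0} - #{weight 2}`. Like the two lemmas that follow, it states the `sl₂` relations
without subtraction, because no ring instance is found on the endomorphisms of
`⨂[ℂ] _ : Fin n, SpinSpace k`, only a semiring. -/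
theorem finrank_ker_inf_ker_add_card {ι : Type*} [Fintype ι] (b : Basis ι ℂ T) {wt : ι → ℤ}
    (hb : ∀ i, h (b i) = (wt i : ℂ) • b i) (hef : e * f = f * e + h)
    (hhe : h * e = e * h + (2 : ℂ) • e) (hhf : h * f + (2 : ℂ) • f = f * h) :
    finrank ℂ ↥(LinearMap.ker h ⊓ LinearMap.ker e) + Fintype.card {i // wt i = 2} =
      Fintype.card {i // wt i = 0} := by
  have := Module.Finite.of_basis b
  rw [← finrank_eigenspace_eq_card b hb, ← finrank_eigenspace_eq_card b hb, Int.cast_zero]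
  have := finrank_ker_inf_ker_add_finrank_eigenspace_two (sub_eq_iff_eq_add'.2 hef)
    (sub_eq_iff_eq_add'.2 hhe)
    (by rw [neg_smul, sub_eq_iff_eq_add, ← hhf]; abel)
  exact_mod_cast this

/-- A vector killed by `h` and `e` is killed by `f`, because `f v` would otherwise be a highest weight
vector of weight `-2`. -/
theorem apply_eq_zero_of_ker [FiniteDimensional ℂ T] (hef : e * f = f * e + h)
    (hhf : h * f + (2 : ℂ) • f = f * h) {v : T} (hv : h v = 0) (hev : e v = 0) : f v = 0 := by
  have h1 := LinearMap.congr_fun hef v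
  have h2 := LinearMap.congr_fun hhf v
  simp only [LinearMap.add_apply, Module.End.mul_apply, LinearMap.smul_apply, hv, hev,
    map_zero, add_zero] at h1 h2
  refine eq_zero_of_raise_eq_zero (sub_eq_iff_eq_add'.2 hef)
    (by rw [neg_smul, sub_eq_iff_eq_add, ← hhf]; abel) ?_ h1
  rw [neg_smul, eq_neg_iff_add_eq_zero, h2]

/-- A vector of weight `0` killed by the compact generator `f - e` is killed by `e`, because `e v`
and `f v` have different weights. -/
theorem apply_eq_zero_of_rotation (hhe : h * e = e * h + (2 : ℂ) • e)
    (hhf : h * f + (2 : ℂ) • f = f * h) {v : T} (hv : h v = 0) (hfe : f v + (-1 : ℂ) • e v = 0) :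
    e v = 0 := by
  have h1 := LinearMap.congr_fun hhe v
  have h2 := LinearMap.congr_fun hhf v
  rw [neg_one_smul, ← sub_eq_add_neg, sub_eq_zero] at hfe
  simp only [LinearMap.add_apply, Module.End.mul_apply, LinearMap.smul_apply, hv,
    map_zero, zero_add, hfe] at h1 h2
  rw [h1, ← add_smul] at h2
  exact (smul_eq_zero.1 h2).resolve_left (by norm_num)

end SlTwo

end SpinHorizon

/-! ### The infinitesimal action on tensor powers -/

noncomputable section
namespace SpinHorizon

open MvPolynomial

/-- The infinitesimal version of `subst`: the derivation of `ℂ[X₀, X₁]` that acts on the span of the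
two variables by the matrix `a`. -/
def substDerivation (a : Matrix (Fin 2) (Fin 2) ℂ) :
    Derivation ℂ (MvPolynomial (Fin 2) ℂ) (MvPolynomial (Fin 2) ℂ) :=
  mkDerivation ℂ fun i => ∑ j, C (a j i) * X j

theorem substDerivation_X (a : Matrix (Fin 2) (Fin 2) ℂ) (i : Fin 2) :
    substDerivation a (X i) = ∑ j, C (a j i) * X j :=
  mkDerivation_X (R := ℂ) (fun i => ∑ j, C (a j i) * X j) i

theorem substDerivation_eq_sum_pderiv (a : Matrix (Fin 2) (Fin 2) ℂ)
    (p : MvPolynomial (Fin 2) ℂ) :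
    substDerivation a p = ∑ i, (∑ j, C (a j i) * X j) * pderiv i p := by
  have : substDerivation a = ∑ i, (∑ j, C (a j i) * X j) • pderiv i := by
    refine derivation_ext fun i => ?_
    rw [substDerivation_X]
    fin_cases i <;> simp [Derivation.add_apply]
  rw [this]
  simp [Derivation.add_apply]

theorem substDerivation_mem (a : Matrix (Fin 2) (Fin 2) ℂ) (k : ℕ) :
    ∀ p ∈ homogeneousSubmodule (Fin 2) ℂ k,
      (substDerivation a : MvPolynomial (Fin 2) ℂ →ₗ[ℂ] MvPolynomial (Fin 2) ℂ) p ∈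
        homogeneousSubmodule (Fin 2) ℂ k := by
  intro p hp
  rw [mem_homogeneousSubmodule] at hp ⊢
  rw [Derivation.coeFn_coe, substDerivation_eq_sum_pderiv]
  refine IsHomogeneous.sum _ _ _ fun i _ => ?_
  obtain _ | k := k
  · rw [← totalDegree_zero_iff_isHomogeneous, totalDegree_eq_zero_iff_eq_C] at hp
    rw [hp, pderiv_C, mul_zero]
    exact isHomogeneous_zero _ _ _
  · rw [add_comm k 1]
    exact (IsHomogeneous.sum _ _ _ fun j _ => isHomogeneous_C_mul_X _ _).mul hp.pderiv

/-- The action of `gl₂` on `V^s`, `s = k / 2`, obtained by differentiating that of `SU(2)`. -/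
def spinLie (k : ℕ) : Matrix (Fin 2) (Fin 2) ℂ →ₗ[ℂ] Module.End ℂ (SpinSpace k) where
  toFun a := (substDerivation a : MvPolynomial (Fin 2) ℂ →ₗ[ℂ] _).restrict (substDerivation_mem a k)
  map_add' a b := by
    have : substDerivation (a + b) = substDerivation a + substDerivation b :=
      derivation_ext fun i => by
        simp only [substDerivation_X, Derivation.add_apply, Matrix.add_apply, map_add, add_mul,
          Finset.sum_add_distrib]
    ext p : 2
    simp [LinearMap.restrict_apply, this]
  map_smul' c a := by
    have : substDerivation (c • a) = c • substDerivation a :=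
      derivation_ext fun i => by
        simp only [substDerivation_X, Derivation.smul_apply, Matrix.smul_apply, smul_eq_mul, map_mul,
          Finset.smul_sum, smul_eq_C_mul, mul_assoc]
    ext p : 2
    simp [LinearMap.restrict_apply, this]

theorem spinLie_mul (k : ℕ) {a b c : Matrix (Fin 2) (Fin 2) ℂ} (h : a * b = b * a + c) :
    spinLie k a * spinLie k b = spinLie k b * spinLie k a + spinLie k c := by
  have : substDerivation c = ⁅substDerivation a, substDerivation b⁆ := by
    rw [eq_sub_of_add_eq' h.symm]
    refine derivation_ext fun i => ?_
    simp only [Derivation.commutator_apply, substDerivation_X, Matrix.sub_apply,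
      Matrix.mul_apply, Fin.sum_univ_two, map_add, Derivation.leibniz, derivation_C, smul_eq_mul,
      map_sub, map_mul]
    ring
  ext p : 2
  change substDerivation a (substDerivation b (p : MvPolynomial (Fin 2) ℂ)) =
    substDerivation b (substDerivation a (p : MvPolynomial (Fin 2) ℂ)) + substDerivation c p
  rw [this, Derivation.commutator_apply, add_sub_cancel]

theorem coe_spinLie_apply (k : ℕ) (a : Matrix (Fin 2) (Fin 2) ℂ) (p : SpinSpace k) :
    (spinLie k a p : MvPolynomial (Fin 2) ℂ) = substDerivation a p := rfl

theorem coe_spinRep_apply (k : ℕ) (g : SU2) (p : SpinSpace k) :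
    (spinRep k g p : MvPolynomial (Fin 2) ℂ) = subst (g : Matrix (Fin 2) (Fin 2) ℂ) p := rfl

section Leibniz

variable {V : Type*} [AddCommGroup V] [Module ℂ V] (n : ℕ)

/-- The operator `1 ⊗ ⋯ ⊗ A ⊗ ⋯ ⊗ 1` on `V^{⊗ n}`, with `A` in the `i`-th place. -/
def actAt (i : Fin n) (A : Module.End ℂ V) : Module.End ℂ (⨂[ℂ] _ : Fin n, V) :=
  PiTensorProduct.map (Function.update (fun _ => LinearMap.id) i A)

variable {n}

theorem actAt_tprod (i : Fin n) (A : Module.End ℂ V) (m : Fin n → V) :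
    actAt n i A (PiTensorProduct.tprod ℂ m) =
      PiTensorProduct.tprod ℂ (Function.update m i (A (m i))) := by
  rw [actAt, PiTensorProduct.map_tprod]
  congr 1
  ext j
  rcases eq_or_ne j i with rfl | h
  · simp
  · simp [h]

theorem actAt_mul (i : Fin n) (A B : Module.End ℂ V) :
    actAt n i (A * B) = actAt n i A * actAt n i B := by
  refine PiTensorProduct.ext (MultilinearMap.ext fun m => ?_)
  simp [actAt_tprod]

theorem actAt_commute {i j : Fin n} (hij : i ≠ j) (A B : Module.End ℂ V) :
    actAt n i A * actAt n j B = actAt n j B * actAt n i A := by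
  refine PiTensorProduct.ext (MultilinearMap.ext fun m => ?_)
  simp [actAt_tprod, hij, hij.symm, Function.update_comm hij]

theorem actAt_add (i : Fin n) (A B : Module.End ℂ V) :
    actAt n i (A + B) = actAt n i A + actAt n i B := by
  refine PiTensorProduct.ext (MultilinearMap.ext fun m => ?_)
  simp [actAt_tprod]

theorem actAt_smul (i : Fin n) (c : ℂ) (A : Module.End ℂ V) :
    actAt n i (c • A) = c • actAt n i A := by
  refine PiTensorProduct.ext (MultilinearMap.ext fun m => ?_)
  simp [actAt_tprod]

variable (n V)

/-- The action of `End V` on `V^{⊗ n}` by the Leibniz rule. -/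
def leibniz : Module.End ℂ V →ₗ[ℂ] Module.End ℂ (⨂[ℂ] _ : Fin n, V) where
  toFun A := ∑ i, actAt n i A
  map_add' A B := by simp only [actAt_add, Finset.sum_add_distrib]
  map_smul' c A := by simp only [actAt_smul, Finset.smul_sum, RingHom.id_apply]

variable {n V}

theorem leibniz_commutator (A B : Module.End ℂ V) :
    leibniz V n (A * B - B * A) = leibniz V n A * leibniz V n B - leibniz V n B * leibniz V n A := by
  rw [map_sub]
  change (∑ i, actAt n i (A * B)) - ∑ i, actAt n i (B * A) =
    (∑ i, actAt n i A) * (∑ i, actAt n i B) - (∑ i, actAt n i B) * ∑ i, actAt n i A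
  simp only [Finset.sum_mul_sum]
  rw [Finset.sum_comm (f := fun i j => actAt n i B * actAt n j A), ← Finset.sum_sub_distrib,
    ← Finset.sum_sub_distrib]
  refine Finset.sum_congr rfl fun i _ => ?_
  rw [← Finset.sum_sub_distrib, Finset.sum_eq_single i]
  · rw [actAt_mul, actAt_mul]
  · intro j _ hji
    rw [actAt_commute hji.symm, sub_self]
  · simp

theorem leibniz_tprod (A : Module.End ℂ V) (m : Fin n → V) :
    leibniz V n A (PiTensorProduct.tprod ℂ m) =
      ∑ i, PiTensorProduct.tprod ℂ (Function.update m i (A (m i))) := by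
  change (∑ i, actAt n i A) _ = _
  simp only [LinearMap.sum_apply, actAt_tprod]

theorem leibniz_mul {A B D : Module.End ℂ V} (h : A * B = B * A + D) :
    leibniz V n A * leibniz V n B = leibniz V n B * leibniz V n A + leibniz V n D := by
  rw [← sub_eq_iff_eq_add', ← leibniz_commutator, h, add_sub_cancel_left]

end Leibniz

/-- The action of `gl₂` on `(V^s)^{⊗ n}`, `s = k / 2`. -/
def tensorLie (k n : ℕ) :
    Matrix (Fin 2) (Fin 2) ℂ →ₗ[ℂ] Module.End ℂ (⨂[ℂ] _ : Fin n, SpinSpace k) :=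
  leibniz (SpinSpace k) n ∘ₗ spinLie k

theorem tensorLie_mul (k n : ℕ) {a b c : Matrix (Fin 2) (Fin 2) ℂ} (h : a * b = b * a + c) :
    tensorLie k n a * tensorLie k n b = tensorLie k n b * tensorLie k n a + tensorLie k n c :=
  leibniz_mul (spinLie_mul k h)

theorem tensorLie_tprod (k n : ℕ) (a : Matrix (Fin 2) (Fin 2) ℂ) (m : Fin n → SpinSpace k) :
    tensorLie k n a (PiTensorProduct.tprod ℂ m) =
      ∑ i, PiTensorProduct.tprod ℂ (Function.update m i (spinLie k a (m i))) :=
  leibniz_tprod _ _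

/-- The exponent of the monomial `X₀ ^ i * X₁ ^ (k - i)`. -/
def expo (k : ℕ) (i : Fin (k + 1)) : Fin 2 →₀ ℕ :=
  Finsupp.single 0 (i : ℕ) + Finsupp.single 1 (k - i)

theorem expo_zero (k : ℕ) (i : Fin (k + 1)) : expo k i 0 = i := by simp [expo]

theorem expo_one (k : ℕ) (i : Fin (k + 1)) : expo k i 1 = k - i := by simp [expo]

theorem degree_expo (k : ℕ) (i : Fin (k + 1)) : (expo k i).degree = k := by
  rw [Finsupp.degree_eq_sum, Fin.sum_univ_two, expo_zero, expo_one]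
  omega

theorem expo_injective (k : ℕ) : Function.Injective (expo k) := fun i j h => by
  have := DFunLike.congr_fun h 0
  rwa [expo_zero, expo_zero, Fin.val_inj] at this

theorem exists_expo_eq {k : ℕ} {d : Fin 2 →₀ ℕ} (hd : d.degree = k) : ∃ i, expo k i = d := by
  rw [Finsupp.degree_eq_sum, Fin.sum_univ_two] at hd
  refine ⟨⟨d 0, by omega⟩, Finsupp.ext fun j => ?_⟩
  fin_cases j
  · exact expo_zero _ _
  · refine (expo_one _ _).trans ?_
    simp
    omega

/-- The basis of `V^s`, `s = k / 2`, that consists of the monomials `X₀ ^ i * X₁ ^ (k - i)`. -/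
def spinBasis (k : ℕ) : Module.Basis (Fin (k + 1)) ℂ (SpinSpace k) :=
  Module.Basis.ofEquivFun
    { toFun := fun p i => coeff (expo k i) (p : MvPolynomial (Fin 2) ℂ)
      map_add' := fun p q => by ext i; simp
      map_smul' := fun c p => by ext i; simp
      invFun := fun c => ⟨∑ i, monomial (expo k i) (c i), by
        rw [mem_homogeneousSubmodule]
        exact IsHomogeneous.sum _ _ _ fun i _ => isHomogeneous_monomial _ (degree_expo k i)⟩
      left_inv := fun p => by
        refine Subtype.ext (MvPolynomial.ext _ _ fun d => ?_)
        simp only [coeff_sum, coeff_monomial]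
        by_cases hd : d.degree = k
        · obtain ⟨i, rfl⟩ := exists_expo_eq hd
          simp [(expo_injective k).eq_iff]
        · rw [(show (p : MvPolynomial (Fin 2) ℂ).IsHomogeneous k from p.2).coeff_eq_zero hd]
          refine Finset.sum_eq_zero fun i _ => if_neg ?_
          rintro rfl
          exact hd (degree_expo k i)
      right_inv := fun c => by
        ext i
        simp [coeff_sum, coeff_monomial, (expo_injective k).eq_iff] }

theorem coe_spinBasis (k : ℕ) (i : Fin (k + 1)) :
    (spinBasis k i : MvPolynomial (Fin 2) ℂ) = monomial (expo k i) 1 := by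
  have h : (spinBasis k i : MvPolynomial (Fin 2) ℂ) =
      ∑ j, monomial (expo k j) ((Pi.single i 1 : Fin (k + 1) → ℂ) j) := by
    rw [spinBasis, Module.Basis.coe_ofEquivFun]
    rfl
  rw [h, Finset.sum_eq_single i]
  · simp
  · intro j _ hj
    simp [hj]
  · simp

/-- The basis of `(V^s)^{⊗ n}` made of tensor products of monomials. -/
def tensorBasis (k n : ℕ) :
    Module.Basis (Fin n → Fin (k + 1)) ℂ (⨂[ℂ] _ : Fin n, SpinSpace k) :=
  Basis.piTensorProduct fun _ => spinBasis k

instance (k n : ℕ) : FiniteDimensional ℂ (⨂[ℂ] _ : Fin n, SpinSpace k) :=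
  Module.Finite.of_basis (tensorBasis k n)

end SpinHorizon
end

/-! ### One-parameter subgroups -/

noncomputable section
namespace SpinHorizon

open MvPolynomial

/-- Differentiating `subst` along a curve of matrices through `1` gives the derivation attached to
its velocity, coefficient by coefficient. -/
theorem hasDerivAt_coeff_subst {G : ℝ → Matrix (Fin 2) (Fin 2) ℂ} {a : Matrix (Fin 2) (Fin 2) ℂ}
    (h0 : G 0 = 1) (hG : ∀ i j, HasDerivAt (fun t => G t i j) (a i j) 0)
    (p : MvPolynomial (Fin 2) ℂ) (d : Fin 2 →₀ ℕ) :
    HasDerivAt (fun t => coeff d (subst (G t) p)) (coeff d (substDerivation a p)) 0 := by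
  induction p using MvPolynomial.induction_on generalizing d with
  | C c =>
    simp only [algHom_C, derivation_C, coeff_zero]
    exact hasDerivAt_const _ _
  | add p q hp hq =>
    simp only [map_add, coeff_add]
    exact (hp d).add (hq d)
  | mul_X p i hp =>
    have hX (d : Fin 2 →₀ ℕ) : HasDerivAt (fun t => coeff d (subst (G t) (X i)))
        (coeff d (substDerivation a (X i))) 0 := by
      simp only [subst_X, substDerivation_X, coeff_sum, coeff_C_mul]
      exact HasDerivAt.fun_sum fun j _ => (hG j i).mul_const _
    rw [Derivation.leibniz, smul_eq_mul, smul_eq_mul, mul_comm (X i), coeff_add, coeff_mul,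
      coeff_mul, ← Finset.sum_add_distrib]
    simp only [map_mul, coeff_mul]
    refine HasDerivAt.fun_sum fun x _ => ?_
    refine ((hp x.1).mul (hX x.2)).congr_deriv ?_
    rw [h0, subst_one]
    simp only [AlgHom.id_apply]
    ring

theorem tensorRep_tprod (k n : ℕ) (g : SU2) (m : Fin n → SpinSpace k) :
    tensorRep k n g (PiTensorProduct.tprod ℂ m) = PiTensorProduct.tprod ℂ fun i => spinRep k g (m i) :=
  PiTensorProduct.map_tprod _ _

theorem tensorBasis_repr_tprod (k n : ℕ) (m : Fin n → SpinSpace k) (p : Fin n → Fin (k + 1)) :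
    (tensorBasis k n).repr (PiTensorProduct.tprod ℂ m) p =
      ∏ i, coeff (expo k (p i)) (m i : MvPolynomial (Fin 2) ℂ) :=
  Basis.piTensorProduct_repr_tprod_apply _ _ _

/-- A differentiable one-parameter subgroup of `SU(2)` with velocity `a`. -/
structure IsOneParam (g : ℝ → SU2) (a : Matrix (Fin 2) (Fin 2) ℂ) : Prop where
  apply_zero : g 0 = 1
  apply_add : ∀ s t, g (s + t) = g s * g t
  hasDerivAt : ∀ i j, HasDerivAt (fun t => (g t : Matrix (Fin 2) (Fin 2) ℂ) i j) (a i j) 0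

namespace IsOneParam

variable {g : ℝ → SU2} {a : Matrix (Fin 2) (Fin 2) ℂ} {k n : ℕ}

/-- The Leibniz rule: each coordinate of a pure tensor is a product of coefficients, one for each
factor, which are differentiated by `hasDerivAt_coeff_subst`. -/
theorem hasDerivAt_repr (hg : IsOneParam g a) (v : ⨂[ℂ] _ : Fin n, SpinSpace k)
    (p : Fin n → Fin (k + 1)) :
    HasDerivAt (fun t => (tensorBasis k n).repr (tensorRep k n (g t) v) p)
      ((tensorBasis k n).repr (tensorLie k n a v) p) 0 := by
  induction v using PiTensorProduct.induction_on with
  | smul_tprod r m =>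
    simp only [map_smul, Finsupp.smul_apply, smul_eq_mul]
    refine HasDerivAt.const_mul r ?_
    simp only [tensorRep_tprod, tensorLie_tprod, map_sum, Finsupp.coe_finsetSum, Finset.sum_apply,
      tensorBasis_repr_tprod]
    have hm (i : Fin n) := hasDerivAt_coeff_subst (G := fun t => (g t : Matrix (Fin 2) (Fin 2) ℂ))
      (by rw [hg.apply_zero]; rfl) hg.hasDerivAt (m i : MvPolynomial (Fin 2) ℂ) (expo k (p i))
    refine (HasDerivAt.fun_finsetProd fun i _ => hm i).congr_deriv ?_
    refine Finset.sum_congr rfl fun i _ => ?_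
    rw [← Finset.prod_erase_mul _ _ (Finset.mem_univ i), smul_eq_mul]
    congr 1
    -- At `t = 0` the group element is `1`, so the undifferentiated factors are those of `m`.
    · refine Finset.prod_congr rfl fun j hj => ?_
      rw [Function.update_of_ne (Finset.ne_of_mem_erase hj), hg.apply_zero]
      simp [subst_one]
    · rw [Function.update_self, coe_spinLie_apply]
  | add v w hv hw =>
    simp only [map_add, Finsupp.add_apply]
    exact hv.add hw

theorem hasDerivAt_dual (hg : IsOneParam g a) (v : ⨂[ℂ] _ : Fin n, SpinSpace k)
    (φ : (⨂[ℂ] _ : Fin n, SpinSpace k) →ₗ[ℂ] ℂ) :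
    HasDerivAt (fun t => φ (tensorRep k n (g t) v)) (φ (tensorLie k n a v)) 0 := by
  have hφ (w) : φ w = ∑ p, (tensorBasis k n).repr w p * φ (tensorBasis k n p) := by
    conv_lhs => rw [← (tensorBasis k n).sum_repr w]
    simp only [map_sum, map_smul, smul_eq_mul]
  simp only [hφ (tensorRep k n _ v), hφ (tensorLie k n a v)]
  exact HasDerivAt.fun_sum fun p _ => (hg.hasDerivAt_repr v p).mul_const _

/-- A vector is fixed by a one-parameter subgroup if and only if its generator kills it. -/
theorem forall_tensorRep_eq_iff (hg : IsOneParam g a) (v : ⨂[ℂ] _ : Fin n, SpinSpace k) :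
    (∀ t, tensorRep k n (g t) v = v) ↔ tensorLie k n a v = 0 := by
  constructor
  · intro h
    refine (tensorBasis k n).ext_elem fun p => ?_
    have := hg.hasDerivAt_repr v p
    simp only [h] at this
    rw [this.unique (hasDerivAt_const (0 : ℝ) _), map_zero, Finsupp.zero_apply]
  · intro h t
    refine (tensorBasis k n).ext_elem fun p => ?_
    let c := (tensorBasis k n).coord p
    -- As `g s = g t * g (s - t)`, the derivative at `t` is read off from the one at `0`.
    have hderiv (t : ℝ) : HasDerivAt (fun s => c (tensorRep k n (g s) v)) 0 t := by
      have h1 := hg.hasDerivAt_dual v (c ∘ₗ tensorRep k n (g t))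
      rw [h, LinearMap.map_zero] at h1
      have h2 : HasDerivAt (fun s : ℝ => s - t) 1 t := (hasDerivAt_id t).sub_const t
      refine HasDerivAt.scomp_of_eq t h1 h2 (sub_self t).symm |>.congr_deriv
        (smul_zero _) |>.congr_of_eventuallyEq (.of_forall fun s => ?_)
      change c (tensorRep k n (g s) v) = c (tensorRep k n (g t) (tensorRep k n (g (s - t)) v))
      rw [← Module.End.mul_apply, ← map_mul, ← hg.apply_add, add_sub_cancel]
    have := is_const_of_deriv_eq_zero (fun t => (hderiv t).differentiableAt)
      (fun t => (hderiv t).deriv) t 0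
    simpa [hg.apply_zero, c] using this

end IsOneParam

/-! ### Invariants of `SU(2)` -/

/-- The diagonal torus of `SU(2)`. -/
def torus (t : ℝ) : SU2 :=
  ⟨!![Complex.exp (t * Complex.I), 0; 0, Complex.exp (-(t * Complex.I))], by
    rw [Matrix.mem_specialUnitaryGroup_iff, Matrix.mem_unitaryGroup_iff]
    constructor
    · ext i j
      fin_cases i <;> fin_cases j <;>
        simp [Matrix.mul_apply, Matrix.star_apply, ← Complex.exp_conj, ← Complex.exp_add]
    · simp [Matrix.det_fin_two, ← Complex.exp_add]⟩

/-- The real rotations in `SU(2)`. -/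
def rotation (t : ℝ) : SU2 :=
  ⟨!![(Real.cos t : ℂ), -(Real.sin t : ℂ); (Real.sin t : ℂ), (Real.cos t : ℂ)], by
    have h : (Real.cos t : ℂ) * Real.cos t + Real.sin t * Real.sin t = 1 := by
      rw [← sq, ← sq]
      exact_mod_cast Real.cos_sq_add_sin_sq t
    rw [Matrix.mem_specialUnitaryGroup_iff, Matrix.mem_unitaryGroup_iff]
    constructor
    · ext i j
      fin_cases i <;> fin_cases j <;>
        simp [Matrix.mul_apply, Matrix.star_apply, -Complex.ofReal_cos, -Complex.ofReal_sin,
          Complex.conj_ofReal]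
      · exact h
      · ring
      · ring
      · rw [add_comm]; exact h
    · rw [Matrix.det_fin_two_of, ← h]; ring⟩

/-- The weight operator of `sl₂`. -/
def matH : Matrix (Fin 2) (Fin 2) ℂ := !![1, 0; 0, -1]

/-- The raising operator of `sl₂`. -/
def matE : Matrix (Fin 2) (Fin 2) ℂ := !![0, 1; 0, 0]

/-- The lowering operator of `sl₂`. -/
def matF : Matrix (Fin 2) (Fin 2) ℂ := !![0, 0; 1, 0]

theorem tensorLie_matE_mul_matF (k n : ℕ) :
    tensorLie k n matE * tensorLie k n matF =
      tensorLie k n matF * tensorLie k n matE + tensorLie k n matH :=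
  tensorLie_mul k n (by
    ext i j; fin_cases i <;> fin_cases j <;> norm_num [matE, matF, matH])

theorem tensorLie_matH_mul_matE (k n : ℕ) :
    tensorLie k n matH * tensorLie k n matE =
      tensorLie k n matE * tensorLie k n matH + (2 : ℂ) • tensorLie k n matE := by
  rw [← map_smul]
  exact tensorLie_mul k n (by ext i j; fin_cases i <;> fin_cases j <;> norm_num [matE, matH])

theorem tensorLie_matH_mul_matF (k n : ℕ) :
    tensorLie k n matH * tensorLie k n matF + (2 : ℂ) • tensorLie k n matF =
      tensorLie k n matF * tensorLie k n matH := by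
  rw [← map_smul]
  exact (tensorLie_mul k n (by ext i j; fin_cases i <;> fin_cases j <;> norm_num [matF, matH])).symm

theorem isOneParam_torus : IsOneParam torus (Complex.I • matH) where
  apply_zero := by
    ext i j
    fin_cases i <;> fin_cases j <;> simp [torus]
  apply_add s t := by
    ext i j
    fin_cases i <;> fin_cases j <;>
      simp [torus, ← Complex.exp_add] <;> ring_nf
  hasDerivAt i j := by
    have h : HasDerivAt (fun t : ℝ => (t : ℂ) * Complex.I) Complex.I 0 := by
      simpa using (Complex.ofRealCLM.hasDerivAt (x := (0 : ℝ))).mul_const Complex.I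
    fin_cases i <;> fin_cases j
    · simpa [torus, matH] using h.cexp
    · simpa [torus, matH] using hasDerivAt_const (0 : ℝ) (0 : ℂ)
    · simpa [torus, matH] using hasDerivAt_const (0 : ℝ) (0 : ℂ)
    · simpa [torus, matH] using h.neg.cexp

theorem isOneParam_rotation : IsOneParam rotation (matF + (-1 : ℂ) • matE) where
  apply_zero := by
    ext i j
    fin_cases i <;> fin_cases j <;> simp [rotation]
  apply_add s t := by
    ext i j
    fin_cases i <;> fin_cases j <;>
      simp [rotation, Complex.cos_add, Complex.sin_add] <;> ring
  hasDerivAt i j := by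
    have hc := (Real.hasDerivAt_cos 0).ofReal_comp
    have hs := (Real.hasDerivAt_sin 0).ofReal_comp
    fin_cases i <;> fin_cases j
    · simpa [rotation, matF, matE] using hc
    · simpa [rotation, matF, matE] using hs.fun_neg
    · simpa [rotation, matF, matE] using hs
    · simpa [rotation, matF, matE] using hc

/-- The Euler angle decomposition of `SU(2)`. -/
theorem exists_euler (g : SU2) : ∃ φ θ ψ : ℝ, g = torus φ * rotation θ * torus ψ := by
  obtain ⟨A, hA⟩ := g
  have hdet := (Matrix.mem_specialUnitaryGroup_iff.1 hA).2
  have hstar : star A = A.adjugate := by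
    have h1 := Matrix.mem_unitaryGroup_iff.1 (Matrix.mem_specialUnitaryGroup_iff.1 hA).1
    calc star A = A.adjugate * A * star A := by rw [Matrix.adjugate_mul, hdet, one_smul, one_mul]
      _ = A.adjugate := by rw [mul_assoc, h1, mul_one]
  have h11 : A 1 1 = star (A 0 0) := by
    have := congrFun (congrFun hstar 0) 0
    rw [Matrix.star_apply, Matrix.adjugate_fin_two] at this
    simpa using this.symm
  have h01 : A 0 1 = -star (A 1 0) := by
    have := congrFun (congrFun hstar 0) 1
    rw [Matrix.star_apply, Matrix.adjugate_fin_two] at this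
    rw [this]
    simp
  have hnorm : ‖A 0 0‖ ^ 2 + ‖A 1 0‖ ^ 2 = 1 := by
    rw [Matrix.det_fin_two, h11, h01] at hdet
    have h2 : ((‖A 0 0‖ ^ 2 + ‖A 1 0‖ ^ 2 : ℝ) : ℂ) = 1 := by
      rw [← hdet]
      push_cast
      rw [← Complex.mul_conj', ← Complex.mul_conj']
      simp only [Complex.star_def]
      ring
    exact_mod_cast h2
  obtain ⟨θ, hc, hs⟩ : ∃ θ : ℝ, Real.cos θ = ‖A 0 0‖ ∧ Real.sin θ = ‖A 1 0‖ := by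
    refine ⟨Real.arccos ‖A 0 0‖, Real.cos_arccos ?_ ?_, ?_⟩
    · linarith [norm_nonneg (A 0 0)]
    · nlinarith [norm_nonneg (A 0 0), sq_nonneg ‖A 1 0‖]
    · rw [Real.sin_arccos, ← eq_sub_iff_add_eq'.2 hnorm, Real.sqrt_sq (norm_nonneg _)]
  set α := (A 0 0).arg
  set β := (A 1 0).arg
  have h00 : A 0 0 = Real.cos θ * Complex.exp (α * Complex.I) := by
    rw [hc, Complex.norm_mul_exp_arg_mul_I]
  have h10 : A 1 0 = Real.sin θ * Complex.exp (β * Complex.I) := by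
    rw [hs, Complex.norm_mul_exp_arg_mul_I]
  have hconj (x : ℝ) : star (Complex.exp (x * Complex.I)) = Complex.exp (-(x * Complex.I)) := by
    rw [Complex.star_def, ← Complex.exp_conj]
    simp
  have hentries : A = !![Real.cos θ * Complex.exp (α * Complex.I),
      -(Real.sin θ * Complex.exp (-(β * Complex.I)));
      Real.sin θ * Complex.exp (β * Complex.I), Real.cos θ * Complex.exp (-(α * Complex.I))] := by
    rw [Matrix.eta_fin_two A, h11, h01, h00, h10]
    simp only [star_mul', hconj, Complex.star_def, Complex.conj_ofReal]
  refine ⟨(α - β) / 2, θ, (α + β) / 2, Subtype.ext ?_⟩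
  have hα : Complex.exp (α * Complex.I) = Complex.exp (((α - β) / 2 : ℝ) * Complex.I) *
      Complex.exp (((α + β) / 2 : ℝ) * Complex.I) := by
    rw [← Complex.exp_add]; congr 1; push_cast; ring
  have hα' : Complex.exp (-(α * Complex.I)) = Complex.exp (-(((α - β) / 2 : ℝ) * Complex.I)) *
      Complex.exp (-(((α + β) / 2 : ℝ) * Complex.I)) := by
    rw [← Complex.exp_add]; congr 1; push_cast; ring
  have hβ : Complex.exp (β * Complex.I) = Complex.exp (-(((α - β) / 2 : ℝ) * Complex.I)) *
      Complex.exp (((α + β) / 2 : ℝ) * Complex.I) := by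
    rw [← Complex.exp_add]; congr 1; push_cast; ring
  have hβ' : Complex.exp (-(β * Complex.I)) = Complex.exp (((α - β) / 2 : ℝ) * Complex.I) *
      Complex.exp (-(((α + β) / 2 : ℝ) * Complex.I)) := by
    rw [← Complex.exp_add]; congr 1; push_cast; ring
  change A = (torus _ : Matrix (Fin 2) (Fin 2) ℂ) * rotation θ * torus _
  rw [hentries, hα, hα', hβ, hβ']
  simp only [torus, rotation, Matrix.mul_fin_two]
  congr! 3 <;> ring_nf

/-- The invariants of `SU(2)` are the vectors of weight zero killed by the raising operator. -/
theorem intertwinerSpace_eq (k n : ℕ) :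
    intertwinerSpace k n =
      LinearMap.ker (tensorLie k n matH) ⊓ LinearMap.ker (tensorLie k n matE) := by
  ext v
  have htorus : (∀ t, tensorRep k n (torus t) v = v) ↔ tensorLie k n matH v = 0 := by
    rw [isOneParam_torus.forall_tensorRep_eq_iff, map_smul, LinearMap.smul_apply,
      smul_eq_zero_iff_right Complex.I_ne_zero]
  have hrot : (∀ t, tensorRep k n (rotation t) v = v) ↔
      tensorLie k n matF v + (-1 : ℂ) • tensorLie k n matE v = 0 := by
    rw [isOneParam_rotation.forall_tensorRep_eq_iff, map_add, map_smul, LinearMap.add_apply,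
      LinearMap.smul_apply]
  rw [Submodule.mem_inf, LinearMap.mem_ker, LinearMap.mem_ker]
  constructor
  -- The arguments `T`, `h`, `e`, `f` are explicit because the additive group structure of the tensor
  -- power agrees with its monoid structure only after unfolding.
  · intro hv
    have hH := htorus.1 fun t => hv _
    exact ⟨hH, apply_eq_zero_of_rotation (T := ⨂[ℂ] _ : Fin n, SpinSpace k)
      (h := tensorLie k n matH) (f := tensorLie k n matF) (e := tensorLie k n matE)
      (tensorLie_matH_mul_matE k n) (tensorLie_matH_mul_matF k n) hH (hrot.1 fun t => hv _)⟩
  · rintro ⟨hH, hE⟩ g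
    have hF := apply_eq_zero_of_ker (T := ⨂[ℂ] _ : Fin n, SpinSpace k)
      (h := tensorLie k n matH) (f := tensorLie k n matF) (e := tensorLie k n matE)
      (tensorLie_matE_mul_matF k n) (tensorLie_matH_mul_matF k n) hH hE
    have hR := hrot.2 (by rw [hF, hE, smul_zero, add_zero])
    obtain ⟨φ, θ, ψ, rfl⟩ := exists_euler g
    rw [map_mul, map_mul, Module.End.mul_apply, Module.End.mul_apply, htorus.2 hH, hR, htorus.2 hH]

/-- The weight of a tensor product of monomials: each factor `X₀ ^ i * X₁ ^ (k - i)` has weight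
`2 * i - k`. -/
theorem tensorLie_matH_tensorBasis (k n : ℕ) (p : Fin n → Fin (k + 1)) :
    tensorLie k n matH (tensorBasis k n p) =
      ((∑ i, (2 * (p i : ℤ) - k) : ℤ) : ℂ) • tensorBasis k n p := by
  have h (j : Fin (k + 1)) : spinLie k matH (spinBasis k j) = (2 * (j : ℂ) - k) • spinBasis k j := by
    refine Subtype.ext ?_
    rw [coe_spinLie_apply, Submodule.coe_smul, coe_spinBasis, substDerivation_eq_sum_pderiv]
    have hH : ∀ q : MvPolynomial (Fin 2) ℂ, ∑ i, (∑ l, C (matH l i) * X l) * pderiv i q =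
        X 0 * pderiv 0 q - X 1 * pderiv 1 q := fun q => by
      simp [Fin.sum_univ_two, matH, sub_eq_add_neg]
    rw [hH, X_mul_pderiv_monomial, X_mul_pderiv_monomial, expo_zero, expo_one,
      ← Nat.cast_smul_eq_nsmul ℂ, ← Nat.cast_smul_eq_nsmul ℂ, ← sub_smul,
      Nat.cast_sub (Nat.le_of_lt_succ j.2)]
    congr 1
    ring
  rw [tensorBasis, Basis.piTensorProduct_apply, tensorLie_tprod]
  simp only [h, MultilinearMap.map_update_smul, Function.update_eq_self]
  rw [← Finset.sum_smul]
  congr 1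
  push_cast
  rfl

theorem finrank_intertwinerSpace_add (k n : ℕ) :
    Module.finrank ℂ (intertwinerSpace k n) + RW k n 2 = RW k n 0 := by
  have h := finrank_ker_inf_ker_add_card (T := ⨂[ℂ] _ : Fin n, SpinSpace k)
      (h := tensorLie k n matH) (f := tensorLie k n matF) (e := tensorLie k n matE)
      (tensorBasis k n) (tensorLie_matH_tensorBasis k n)
    (tensorLie_matE_mul_matF k n) (tensorLie_matH_mul_matE k n) (tensorLie_matH_mul_matF k n)
  rw [← intertwinerSpace_eq] at h
  simpa only [RW, walkCount_freeStep_eq_card, zero_add] using h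

theorem finrank_intertwinerSpace (k n : ℕ) :
    Module.finrank ℂ (intertwinerSpace k n) = RWM k n 0 :=
  Nat.add_right_cancel ((finrank_intertwinerSpace_add k n).trans (RWM_zero_add_RW_two k n).symm)

theorem spinRep_zero (g : SU2) (p : SpinSpace 0) : spinRep 0 g p = p := by
  refine Subtype.ext ?_
  have hp : (p : MvPolynomial (Fin 2) ℂ).IsHomogeneous 0 := p.2
  rw [← totalDegree_zero_iff_isHomogeneous, totalDegree_eq_zero_iff_eq_C] at hp
  rw [coe_spinRep_apply, hp, algHom_C, algebraMap_eq]

/-- The multiplicity of the trivial representation is the dimension of the invariants: an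
equivariant map is determined by the image of the constant polynomial `1`. -/
theorem degeneracy_zero (k n : ℕ) :
    degeneracy k n 0 = Module.finrank ℂ (intertwinerSpace k n) := by
  let one : SpinSpace 0 := spinBasis 0 0
  refine LinearEquiv.finrank_eq
    { toFun := fun φ => ⟨φ one, fun g => by rw [← φ.isIntertwining, spinRep_zero]⟩
      map_add' := fun φ ψ => rfl
      map_smul' := fun c φ => rfl
      invFun := fun v =>
        { toLinearMap := ((spinBasis 0).coord 0).smulRight (v : ⨂[ℂ] _ : Fin n, SpinSpace k)
          isIntertwining' := fun g => by
            ext p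
            simp only [LinearMap.comp_apply, spinRep_zero, LinearMap.smulRight_apply, map_smul]
            rw [v.2 g] }
      left_inv := fun φ => by
        refine Representation.IntertwiningMap.ext ((spinBasis 0).ext fun i => ?_)
        rw [Fin.fin_one_eq_zero i]
        change (spinBasis 0).coord 0 (spinBasis 0 0) • φ one = φ one
        simp
      right_inv := fun v => by
        refine Subtype.ext ?_
        change (spinBasis 0).coord 0 (spinBasis 0 0) • (v : ⨂[ℂ] _ : Fin n, SpinSpace k) = v
        simp }

end SpinHorizon
end

/-! ### Fourier inversion and Laplace's method -/

noncomputable section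
namespace SpinHorizon

open MeasureTheory Real

/-- The character of `V^s`, `s = k / 2`, at the rotation of angle `2 θ`: the Fourier transform of
one step of the free walk. -/
def spinChar (k : ℕ) (θ : ℝ) : ℝ := ∑ i ∈ Finset.range (k + 1), cos ((2 * i - k) * θ)

theorem continuous_spinChar (k : ℕ) : Continuous (spinChar k) := by
  unfold spinChar
  fun_prop

theorem sum_cos_add (k : ℕ) (D θ : ℝ) :
    ∑ i ∈ Finset.range (k + 1), cos ((D - k + 2 * i) * θ) = spinChar k θ * cos (D * θ) := by
  have hsin : ∑ i ∈ Finset.range (k + 1), sin ((2 * i - k) * θ) = 0 := by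
    have h := Finset.sum_range_reflect (fun i : ℕ => sin ((2 * i - k) * θ)) (k + 1)
    have h' : ∑ i ∈ Finset.range (k + 1), sin ((2 * ((k + 1 - 1 - i : ℕ) : ℝ) - k) * θ) =
        -∑ i ∈ Finset.range (k + 1), sin ((2 * i - k) * θ) := by
      rw [← Finset.sum_neg_distrib]
      refine Finset.sum_congr rfl fun i hi => ?_
      have hi' : i ≤ k := Nat.lt_succ_iff.1 (Finset.mem_range.1 hi)
      rw [← sin_neg, Nat.add_sub_cancel, Nat.cast_sub hi']
      congr 1
      ring
    linarith
  have hterm (i : ℕ) : cos ((D - k + 2 * i) * θ) =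
      cos ((2 * i - k) * θ) * cos (D * θ) - sin ((2 * i - k) * θ) * sin (D * θ) := by
    rw [← cos_add]
    congr 1
    ring
  simp only [hterm, Finset.sum_sub_distrib, ← Finset.sum_mul, hsin, zero_mul, sub_zero]
  rfl

theorem integral_cos_two_mul_int {m : ℤ} (hm : m ≠ 0) :
    ∫ θ in -(π / 2)..π / 2, cos (2 * m * θ) = 0 := by
  have h2 : (2 * m : ℝ) ≠ 0 := by exact_mod_cast mul_ne_zero two_ne_zero hm
  rw [intervalIntegral.integral_comp_mul_left _ h2, integral_cos,
    show (2 * m : ℝ) * (π / 2) = m * π by ring, show (2 * m : ℝ) * -(π / 2) = -(m * π) by ring,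
    sin_neg, sin_int_mul_pi]
  simp

/-- Fourier inversion for the free walk. As the walk keeps the parity of its position up to that
of `n * k`, the integrand has period `π`, and half of the usual period is enough. -/
theorem pi_mul_walkCount (k n : ℕ) (x y : ℤ) (h : Even (x - y + n * k)) :
    π * walkCount (freeStep k) n x y =
      ∫ θ in -(π / 2)..π / 2, spinChar k θ ^ n * cos ((x - y) * θ) := by
  induction n generalizing x with
  | zero =>
    simp only [walkCount, pow_zero, one_mul]
    split_ifs with hxy
    · simp [hxy]
    · obtain ⟨m, hm⟩ := h
      have hm' : x - y = 2 * m := by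
        rw [← two_mul] at hm
        simpa using hm
      have hm0 : m ≠ 0 := by omega
      rw [← Int.cast_sub, hm']
      push_cast
      rw [integral_cos_two_mul_int hm0, mul_zero]
  | succ n ih =>
    simp only [walkCount, sum_freeStep, Nat.cast_sum, Finset.mul_sum]
    have hcont := continuous_spinChar k
    have hstep (i : ℕ) : π * (walkCount (freeStep k) n (x - k + 2 * i) y : ℝ) =
        ∫ θ in -(π / 2)..π / 2, spinChar k θ ^ n * cos ((((x - y : ℤ) : ℝ) - k + 2 * i) * θ) := by
      rw [ih]
      · refine intervalIntegral.integral_congr fun θ _ => ?_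
        congr 3
        push_cast
        ring
      · obtain ⟨m, hm⟩ := h
        refine ⟨m - k + i, ?_⟩
        push_cast at hm
        linarith
    simp only [hstep]
    rw [← intervalIntegral.integral_finsetSum fun i _ =>
      Continuous.intervalIntegrable (by fun_prop) _ _]
    refine intervalIntegral.integral_congr fun θ _ => ?_
    rw [← Finset.mul_sum, sum_cos_add, pow_succ, mul_assoc, Int.cast_sub]

theorem pi_mul_RW_zero {k n : ℕ} (h : Even (n * k)) :
    π * RW k n 0 = ∫ θ in -(π / 2)..π / 2, spinChar k θ ^ n := by
  rw [RW, pi_mul_walkCount k n 0 0 (by rw [sub_self, zero_add]; exact_mod_cast h)]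
  simp

theorem pi_mul_RWM_zero {k n : ℕ} (h : Even (n * k)) :
    π * RWM k n 0 = 2 * ∫ θ in -(π / 2)..π / 2, spinChar k θ ^ n * sin θ ^ 2 := by
  have hcont := continuous_spinChar k
  have h2 : π * RW k n 2 = ∫ θ in -(π / 2)..π / 2, spinChar k θ ^ n * cos (2 * θ) := by
    rw [RW, pi_mul_walkCount k n 0 2
      (Int.even_add.2 ⟨fun _ => by exact_mod_cast h, fun _ => by decide⟩)]
    refine intervalIntegral.integral_congr fun θ _ => ?_
    rw [← cos_neg (2 * θ)]
    norm_num
  have h3 : (RWM k n 0 : ℝ) = RW k n 0 - RW k n 2 := by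
    rw [eq_sub_iff_add_eq]
    exact_mod_cast RWM_zero_add_RW_two k n
  rw [h3, mul_sub, pi_mul_RW_zero h, h2, ← intervalIntegral.integral_const_mul,
    ← intervalIntegral.integral_sub (Continuous.intervalIntegrable (by fun_prop) _ _)
      (Continuous.intervalIntegrable (by fun_prop) _ _)]
  refine intervalIntegral.integral_congr fun θ _ => ?_
  rw [sin_sq_eq_half_sub]
  ring

/-- A Gaussian bound for the normalized character. Two neighbouring terms add up to
`2 cos ((k - 1) θ) cos θ`, the others are at most `1`. -/
theorem abs_spinChar_div_le {k : ℕ} (hk : 0 < k) {θ : ℝ} (hθ : |θ| ≤ π / 2) :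
    |spinChar k θ / (k + 1)| ≤ exp (-(4 / (π ^ 2 * (k + 1)) * θ ^ 2)) := by
  obtain ⟨l, rfl⟩ := Nat.exists_eq_succ_of_ne_zero hk.ne'
  have hcos0 : 0 ≤ cos θ := cos_nonneg_of_mem_Icc (abs_le.1 hθ)
  have hcos := cos_le_one_sub_mul_cos_sq (hθ.trans (by linarith [pi_pos]))
  have hpair : cos ((2 * ((0 : ℕ) : ℝ) - (l + 1 : ℕ)) * θ) +
      cos ((2 * ((0 + 1 : ℕ) : ℝ) - (l + 1 : ℕ)) * θ) = 2 * cos (l * θ) * cos θ := by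
    rw [cos_add_cos, ← cos_neg (_ / 2), ← cos_neg ((_ - _) / 2)]
    push_cast
    ring_nf
  have hsum : |spinChar (l + 1) θ| ≤ l + 2 * cos θ := by
    rw [spinChar, Finset.sum_range_succ', Finset.sum_range_succ', add_assoc, add_comm (cos _), hpair]
    refine (abs_add_le _ _).trans (add_le_add ?_ ?_)
    · refine (Finset.abs_sum_le_sum_abs _ _).trans ?_
      refine (Finset.sum_le_card_nsmul _ _ 1 fun i _ => abs_cos_le_one _).trans ?_
      simp
    · rw [abs_mul, abs_mul, abs_two, abs_of_nonneg hcos0]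
      have := abs_cos_le_one (l * θ)
      nlinarith
  have hpos : (0 : ℝ) < l + 2 := by positivity
  refine le_trans ?_ (one_sub_le_exp_neg _)
  have hcast : ((l + 1 : ℕ) : ℝ) + 1 = l + 2 := by push_cast; ring
  rw [Nat.succ_eq_add_one, hcast, abs_div, abs_of_pos hpos, div_le_iff₀ hpos]
  refine hsum.trans ?_
  have : (1 - 4 / (π ^ 2 * (l + 2)) * θ ^ 2) * (l + 2) = l + 2 * (1 - 2 / π ^ 2 * θ ^ 2) := by
    field_simp
    ring
  rw [this]
  linarith

theorem tendsto_inv_sqrt_nhdsNE :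
    Tendsto (fun n : ℕ => (√(n : ℝ))⁻¹) atTop (𝓝[≠] 0) := by
  refine tendsto_nhdsWithin_iff.2 ⟨tendsto_inv_atTop_zero.comp
    (tendsto_sqrt_atTop.comp tendsto_natCast_atTop_atTop), ?_⟩
  filter_upwards [eventually_gt_atTop 0] with n hn
  have : 0 < √(n : ℝ) := sqrt_pos.2 (by exact_mod_cast hn)
  exact (inv_pos.2 this).ne'

theorem tendsto_sqrt_mul_sin (t : ℝ) :
    Tendsto (fun n : ℕ => √(n : ℝ) * sin (t / √(n : ℝ))) atTop (𝓝 t) := by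
  have h : HasDerivAt (fun s : ℝ => sin (t * s)) t 0 := by
    simpa using ((hasDerivAt_id (0 : ℝ)).const_mul t).sin
  have := (hasDerivAt_iff_tendsto_slope_zero.1 h).comp tendsto_inv_sqrt_nhdsNE
  simpa [Function.comp_def, div_eq_mul_inv] using this

theorem tendsto_mul_cos_sub_one (b : ℝ) :
    Tendsto (fun n : ℕ => (n : ℝ) * (cos (b / √(n : ℝ)) - 1)) atTop (𝓝 (-(b ^ 2 / 2))) := by
  have h := ((tendsto_sqrt_mul_sin (b / 2)).pow 2).const_mul (-2)
  rw [show -2 * (b / 2) ^ 2 = -(b ^ 2 / 2) by ring] at h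
  refine h.congr fun n => ?_
  rw [mul_pow, sq_sqrt n.cast_nonneg, sin_sq_eq_half_sub,
    show 2 * (b / 2 / √(n : ℝ)) = b / √(n : ℝ) by ring]
  ring

/-- Half of the variance of a step of the free walk. -/
def halfVariance (k : ℕ) : ℝ :=
  (∑ i ∈ Finset.range (k + 1), (2 * (i : ℝ) - k) ^ 2 / 2) / (k + 1)

theorem halfVariance_pos {k : ℕ} (hk : 0 < k) : 0 < halfVariance k := by
  refine div_pos (Finset.sum_pos' (fun i _ => by positivity) ⟨0, by simp, ?_⟩) (by positivity)
  have : (0 : ℝ) < k := by exact_mod_cast hk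
  simp only [Nat.cast_zero, mul_zero, zero_sub, neg_sq]
  positivity

theorem tendsto_spinChar_pow (k : ℕ) (t : ℝ) :
    Tendsto (fun n : ℕ => (spinChar k (t / √(n : ℝ)) / (k + 1)) ^ n) atTop
      (𝓝 (exp (-(halfVariance k * t ^ 2)))) := by
  have hk1 : (k : ℝ) + 1 ≠ 0 := by positivity
  have h : Tendsto (fun n : ℕ => (n : ℝ) * (spinChar k (t / √(n : ℝ)) / (k + 1) - 1)) atTop
      (𝓝 (-(halfVariance k * t ^ 2))) := by
    have h1 := (tendsto_finsetSum (Finset.range (k + 1)) fun i _ =>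
      tendsto_mul_cos_sub_one ((2 * (i : ℝ) - k) * t)).div_const ((k : ℝ) + 1)
    have h2 : (∑ i ∈ Finset.range (k + 1), -(((2 * (i : ℝ) - k) * t) ^ 2 / 2)) / (k + 1) =
        -(halfVariance k * t ^ 2) := by
      rw [halfVariance, div_mul_eq_mul_div, ← neg_div, Finset.sum_neg_distrib, Finset.sum_mul]
      congr 2
      refine Finset.sum_congr rfl fun i _ => ?_
      ring
    rw [h2] at h1
    refine h1.congr fun n => ?_
    rw [← Finset.mul_sum, Finset.sum_sub_distrib, spinChar]
    simp only [mul_div_assoc, Finset.sum_const, Finset.card_range, nsmul_eq_mul, mul_one]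
    generalize ∑ i ∈ Finset.range (k + 1), cos ((2 * (i : ℝ) - k) * (t / √(n : ℝ))) = S
    push_cast
    field_simp
  simpa using tendsto_one_add_pow_exp_of_tendsto h

theorem integrable_pow_mul_gaussian {c : ℝ} (hc : 0 < c) (j : ℕ) :
    Integrable fun t : ℝ => t ^ (2 * j) * exp (-(c * t ^ 2)) := by
  have h := integrable_rpow_mul_exp_neg_mul_sq hc (s := ((2 * j : ℕ) : ℝ))
    (by have : (0 : ℝ) ≤ ((2 * j : ℕ) : ℝ) := Nat.cast_nonneg _; linarith)
  simpa only [rpow_natCast, neg_mul] using h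

/-- Laplace's method at the maximum `θ = 0` of the character. -/
theorem tendsto_laplace {k : ℕ} (hk : 0 < k) (j : ℕ) :
    Tendsto (fun n : ℕ => √(n : ℝ) ^ (2 * j + 1) *
      ∫ θ in -(π / 2)..π / 2, (spinChar k θ / (k + 1)) ^ n * sin θ ^ (2 * j)) atTop
      (𝓝 (∫ t : ℝ, t ^ (2 * j) * exp (-(halfVariance k * t ^ 2)))) := by
  have hcont := continuous_spinChar k
  -- The integrand after the substitution `θ = t / √n`, extended by zero to the whole line.
  set F : ℕ → ℝ → ℝ := fun n => (Set.Ioc (-(π / 2) * √(n : ℝ)) (π / 2 * √(n : ℝ))).indicator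
    fun t => (spinChar k (t / √(n : ℝ)) / (k + 1)) ^ n * (√(n : ℝ) * sin (t / √(n : ℝ))) ^ (2 * j)
  have hF : Tendsto (fun n => ∫ t, F n t) atTop
      (𝓝 (∫ t : ℝ, t ^ (2 * j) * exp (-(halfVariance k * t ^ 2)))) := by
    refine tendsto_integral_filter_of_dominated_convergence
      (fun t => t ^ (2 * j) * exp (-(4 / (π ^ 2 * (k + 1)) * t ^ 2))) ?_ ?_
      (integrable_pow_mul_gaussian (by positivity) j) ?_
    · refine .of_forall fun n => Measurable.aestronglyMeasurable ?_
      refine Measurable.indicator (Continuous.measurable ?_) measurableSet_Ioc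
      fun_prop
    · filter_upwards [eventually_gt_atTop 0] with n hn
      refine .of_forall fun t => ?_
      have hs : 0 < √(n : ℝ) := sqrt_pos.2 (by exact_mod_cast hn)
      by_cases ht : t ∈ Set.Ioc (-(π / 2) * √(n : ℝ)) (π / 2 * √(n : ℝ))
      · rw [show F n t = _ from Set.indicator_of_mem ht _, norm_mul, norm_pow, norm_pow,
          mul_comm, norm_eq_abs, norm_eq_abs]
        refine mul_le_mul ?_ ?_ (by positivity) (by rw [pow_mul]; positivity)
        · rw [pow_mul, pow_mul, sq_abs]
          refine pow_le_pow_left₀ (sq_nonneg _) (sq_le_sq.2 ?_) j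
          rw [abs_mul, abs_of_pos hs]
          refine (mul_le_mul_of_nonneg_left abs_sin_le_abs hs.le).trans_eq ?_
          rw [abs_div, abs_of_pos hs, mul_div_cancel₀ _ hs.ne']
        · have hθ : |t / √(n : ℝ)| ≤ π / 2 := by
            rw [abs_div, abs_of_pos hs, div_le_iff₀ hs, abs_le]
            exact ⟨by linarith [ht.1], ht.2⟩
          refine (pow_le_pow_left₀ (abs_nonneg _) (abs_spinChar_div_le hk hθ) n).trans_eq ?_
          rw [← exp_nat_mul, div_pow, sq_sqrt n.cast_nonneg]
          congr 1
          have : (n : ℝ) ≠ 0 := by exact_mod_cast hn.ne'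
          field_simp
      · rw [show F n t = 0 from Set.indicator_of_notMem ht _, norm_zero]
        exact mul_nonneg (by rw [pow_mul]; positivity) (exp_pos _).le
    · refine .of_forall fun t => ?_
      rw [mul_comm]
      refine ((tendsto_spinChar_pow k t).mul ((tendsto_sqrt_mul_sin t).pow (2 * j))).congr' ?_
      have hlarge : Tendsto (fun n : ℕ => π / 2 * √(n : ℝ)) atTop atTop :=
        (tendsto_sqrt_atTop.comp tendsto_natCast_atTop_atTop).const_mul_atTop (by positivity)
      filter_upwards [hlarge.eventually_gt_atTop |t|] with n hn
      have := abs_lt.1 hn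
      have ht : t ∈ Set.Ioc (-(π / 2) * √(n : ℝ)) (π / 2 * √(n : ℝ)) :=
        ⟨by linarith [this.1], this.2.le⟩
      exact (show F n t = _ from Set.indicator_of_mem ht _).symm
  refine hF.congr' ?_
  filter_upwards [eventually_gt_atTop 0] with n hn
  have hs : 0 < √(n : ℝ) := sqrt_pos.2 (by exact_mod_cast hn)
  rw [integral_indicator measurableSet_Ioc, ← intervalIntegral.integral_of_le
    (mul_le_mul_of_nonneg_right (by linarith [pi_pos]) hs.le)]
  have h := intervalIntegral.integral_comp_div (a := -(π / 2) * √(n : ℝ)) (b := π / 2 * √(n : ℝ))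
    (fun θ => (spinChar k θ / (k + 1)) ^ n * (√(n : ℝ) * sin θ) ^ (2 * j)) hs.ne'
  rw [h, mul_div_cancel_right₀ _ hs.ne', mul_div_cancel_right₀ _ hs.ne', smul_eq_mul, pow_succ',
    mul_assoc, ← intervalIntegral.integral_const_mul (√(n : ℝ) ^ (2 * j))]
  congr 1
  refine intervalIntegral.integral_congr fun θ _ => ?_
  rw [mul_pow]
  ring

theorem integral_pow_mul_gaussian_pos {c : ℝ} (hc : 0 < c) (j : ℕ) :
    0 < ∫ t : ℝ, t ^ (2 * j) * exp (-(c * t ^ 2)) := by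
  refine integral_pos_of_integrable_nonneg_nonzero (x := 1) (by fun_prop)
    (integrable_pow_mul_gaussian hc j) (fun t => ?_) ?_
  · exact mul_nonneg (by rw [pow_mul]; positivity) (exp_pos _).le
  · rw [one_pow, one_mul]
    exact (exp_pos _).ne'

theorem integralTotal_le_atTop (k : ℕ) : integralTotal k ≤ atTop := inf_le_left

theorem eventually_even (k : ℕ) : ∀ᶠ n in integralTotal k, Even (n * k) :=
  mem_inf_of_right (mem_principal_self _)

theorem tendsto_RW_div {k : ℕ} (hk : 0 < k) : ∃ C : ℝ, 0 < C ∧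
    Tendsto (fun n : ℕ => (RW k n 0 : ℝ) / (((k : ℝ) + 1) ^ n / √(n : ℝ))) (integralTotal k)
      (𝓝 C) := by
  refine ⟨_, div_pos (integral_pow_mul_gaussian_pos (halfVariance_pos hk) 0) pi_pos,
    (((tendsto_laplace hk 0).mono_left (integralTotal_le_atTop k)).div_const π).congr' ?_⟩
  filter_upwards [eventually_even k] with n hn
  have h := pi_mul_RW_zero hn
  have hk1 : ((k : ℝ) + 1) ^ n ≠ 0 := by positivity
  simp only [mul_zero, pow_zero, mul_one, zero_add, pow_one, div_pow]
  rw [intervalIntegral.integral_div, ← h]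
  field_simp

theorem tendsto_RWM_div {k : ℕ} (hk : 0 < k) : ∃ C : ℝ, 0 < C ∧
    Tendsto (fun n : ℕ => (RWM k n 0 : ℝ) / (((k : ℝ) + 1) ^ n / ((n : ℝ) * √(n : ℝ))))
      (integralTotal k) (𝓝 C) := by
  refine ⟨_, div_pos (mul_pos two_pos (integral_pow_mul_gaussian_pos (halfVariance_pos hk) 1)) pi_pos,
    ((((tendsto_laplace hk 1).mono_left (integralTotal_le_atTop k)).const_mul 2).div_const π).congr'
      ?_⟩
  filter_upwards [eventually_even k] with n hn
  have h := pi_mul_RWM_zero hn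
  have hk1 : ((k : ℝ) + 1) ^ n ≠ 0 := by positivity
  simp only [mul_one, div_pow, div_mul_eq_mul_div, pow_succ (√(n : ℝ)) 2, sq_sqrt n.cast_nonneg]
  rw [intervalIntegral.integral_div, mul_comm 2, mul_assoc, div_mul_eq_mul_div, mul_comm _ 2, ← h]
  field_simp

theorem isEquivalent_of_tendsto_div {l : Filter ℕ} {u w : ℕ → ℝ} {C : ℝ} (hC : 0 < C)
    (hw : ∀ᶠ n in l, w n ≠ 0) (h : Tendsto (fun n => u n / w n) l (𝓝 C)) :
    u ~[l] fun n => C * w n := by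
  have := ((isEquivalent_const_iff_tendsto hC.ne').2 h).mul (IsEquivalent.refl (u := w))
  refine this.congr_left ?_
  filter_upwards [hw] with n hn
  exact div_mul_cancel₀ _ hn

theorem eventually_pos_integralTotal (k : ℕ) : ∀ᶠ n : ℕ in integralTotal k, 0 < n :=
  integralTotal_le_atTop k (eventually_gt_atTop 0)

end SpinHorizon
end

open SpinHorizon in
theorem proposition6 (k : ℕ) (hk : 0 < k) :
    (∀ n : ℕ, degeneracy k n 0 = Module.finrank ℂ (intertwinerSpace k n) ∧
      degeneracy k n 0 = RWM k n 0) ∧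
    (∃ C : ℝ, 0 < C ∧
      (fun n : ℕ => (RW k n 0 : ℝ)) ~[integralTotal k]
        fun n : ℕ => C * (((k : ℝ) + 1) ^ n / √(n : ℝ))) ∧
    (∃ C : ℝ, 0 < C ∧
      (fun n : ℕ => (degeneracy k n 0 : ℝ)) ~[integralTotal k]
        fun n : ℕ => C * (((k : ℝ) + 1) ^ n / ((n : ℝ) * √(n : ℝ)))) ∧
    (∃ c : ℝ, Tendsto
      (fun n : ℕ => entropy k n - ((n : ℝ) * Real.log ((k : ℝ) + 1) - 3 / 2 * Real.log (n : ℝ)))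
      (integralTotal k) (𝓝 c)) := by
  have hdeg (n : ℕ) : degeneracy k n 0 = RWM k n 0 :=
    (degeneracy_zero k n).trans (finrank_intertwinerSpace k n)
  obtain ⟨C, hC, hRW⟩ := tendsto_RW_div hk
  obtain ⟨D, hD, hRWM⟩ := tendsto_RWM_div hk
  have hpow (n : ℕ) : 0 < ((k : ℝ) + 1) ^ n := by positivity
  refine ⟨fun n => ⟨degeneracy_zero k n, hdeg n⟩, ⟨C, hC, ?_⟩, ⟨D, hD, ?_⟩, ⟨Real.log D, ?_⟩⟩
  · refine isEquivalent_of_tendsto_div hC ?_ hRW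
    filter_upwards [eventually_pos_integralTotal k] with n hn
    have := hpow n
    positivity
  · simp only [hdeg]
    refine isEquivalent_of_tendsto_div hD ?_ hRWM
    filter_upwards [eventually_pos_integralTotal k] with n hn
    have := hpow n
    positivity
  · refine (hRWM.log hD.ne').congr' ?_
    filter_upwards [eventually_pos_integralTotal k, hRWM.eventually_ne hD.ne'] with n hn hne
    have hn' : (0 : ℝ) < n := by exact_mod_cast hn
    rw [entropy, hdeg, Real.log_div (fun h => hne (by rw [h, zero_div])) (by positivity),
      Real.log_div (hpow n).ne' (by positivity), Real.log_mul hn'.ne' (by positivity), Real.log_pow,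
      Real.log_sqrt hn'.le]
    ring
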